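/- Let $\mathcal{E}$ be an elementary topos. A local state classifier of a category $\mathcal{C}$ is an object $\Xi$ with a family of morphisms $\{\xi_X\colon X\to\Xi\}_{X\in\mathrm{ob}(\mathcal{C})}$ that is a colimit cocone under the embedding $\mathcal{C}_{\mathrm{mono}}\to\mathcal{C}$ of the category of all objects and all monomorphisms of $\mathcal{C}$. Suppose that $\mathcal{E}$ has a local state classifier $\{\xi_X\colon X\to\Xi\}_{X\in\mathrm{ob}(\mathcal{E})}$. There is a unique morphism $\wedge\colon\Xi\times\Xi\to\Xi$ with $\wedge\circ(\xi_X\times\xi_Y)=\xi_{X\times Y}$ for all objects $X,Y$; together with $\xi_1\colon 1\to\Xi$ it makes $\Xi$ an internal meet-semilattice, so each $\mathcal{E}(X,\Xi)$ is a meet-semilattice with top $\top=(X\to 1\xrightarrow{\xi_1}\Xi)$ and order $f\le g\iff f\wedge g=f$. Let $\iota_F\colon F\rightarrowtail\Xi$ be an internal filter, i.e. a monomorphism such that for every object $X$ the set of morphisms $X\to\Xi$ that factor through $\iota_F$ contains $\top$, is closed under $\wedge$, and is upward closed. Let $\mathcal{E}_F$ be the full subcategory of $\mathcal{E}$ on the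 objects $Z$ for which $\xi_Z$ factors through $\iota_F$, and for such $Z$ let $\xi^F_Z\colon Z\to F$ be the unique morphism with $\iota_F\circ\xi^F_Z=\xi_Z$. Then: 1. $\mathcal{E}_F$ is an elementary topos, and the inclusion $\mathcal{E}_F\hookrightarrow\mathcal{E}$ is the inverse image of a hyperconnected geometric morphism $\mathcal{E}\to\mathcal{E}_F$, i.e. it is fully faithful, preserves finite limits, and has a right adjoint with monic counit; 2. $F$ is an object of $\mathcal{E}_F$, and the family $\{\xi^F_Z\colon Z\to F\}_{Z\in\mathrm{ob}(\mathcal{E}_F)}$ is a local state classifier of $\mathcal{E}_F$. -/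

import Mathlib

open CategoryTheory CategoryTheory.Limits

universe v u v' u'

namespace LSC

section Topos

/-- An elementary topos: a category with finite limits, cartesian closed (every functor
`X ⨯ (-)` has a right adjoint) and with a subobject classifier. -/
class IsElementaryTopos (E : Type u) [Category.{v} E] : Prop where
  hasFiniteLimits : HasFiniteLimits E
  isLeftAdjoint_prod (X : E) : (prod.functor.obj X).IsLeftAdjoint
  hasSubobjectClassifier : HasSubobjectClassifier E

attribute [instance] IsElementaryTopos.hasFiniteLimits IsElementaryTopos.isLeftAdjoint_prod
  IsElementaryTopos.hasSubobjectClassifier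

/-- A geometric morphism `E → D`: an adjunction `f^* ⊣ f_*` between `f^* : D ⥤ E` and
`f_* : E ⥤ D` whose left adjoint `f^*` preserves finite limits. -/
structure GeometricMorphism (E : Type u) [Category.{v} E] (D : Type u') [Category.{v'} D] where
  inverseImage : D ⥤ E
  directImage : E ⥤ D
  adj : inverseImage ⊣ directImage
  preservesFiniteLimits : PreservesFiniteLimits inverseImage

/-- A geometric morphism is hyperconnected if its inverse image is fully faithful and its counit
`f^* f_* X ⟶ X` is monic for every `X`. -/
structure GeometricMorphism.IsHyperconnected {E : Type u} [Category.{v} E] {D : Type u'}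
    [Category.{v'} D] (f : GeometricMorphism E D) : Prop where
  full : f.inverseImage.Full
  faithful : f.inverseImage.Faithful
  mono_counit (X : E) : Mono (f.adj.counit.app X)

end Topos

section Classifier

variable {E : Type u} [Category.{v} E]

/-- The embedding of the category of all objects and all monomorphisms of `E` into `E`. -/
abbrev monoInclusion (E : Type u) [Category.{v} E] :
    WideSubcategory (MorphismProperty.monomorphisms E) ⥤ E :=
  wideSubcategoryInclusion (MorphismProperty.monomorphisms E)

/-- A family `ξ X : X ⟶ Ξ` compatible with all monomorphisms, as a cocone. -/
def monoCocone {Ξ : E} (ξ : ∀ X : E, X ⟶ Ξ)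
    (w : ∀ {X Y : E} (m : X ⟶ Y) [Mono m], m ≫ ξ Y = ξ X) : Cocone (monoInclusion E) where
  pt := Ξ
  ι :=
    { app := fun X => ξ X.obj
      naturality := fun X Y f => by
        have : Mono f.hom := f.property
        exact (w f.hom).trans (Category.comp_id _).symm }

/-- The family `ξ X : X ⟶ Ξ`, indexed by all objects `X` of `E`, is a local state classifier
of `E`: it is a colimit cocone under the embedding of the category of monomorphisms. -/
def IsLocalStateClassifier {Ξ : E} (ξ : ∀ X : E, X ⟶ Ξ) : Prop :=
  ∃ w : ∀ {X Y : E} (m : X ⟶ Y) [Mono m], m ≫ ξ Y = ξ X, Nonempty (IsColimit (monoCocone ξ w))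

namespace IsLocalStateClassifier

variable {Ξ : E} {ξ : ∀ X : E, X ⟶ Ξ}

lemma w (h : IsLocalStateClassifier ξ) {X Y : E} (m : X ⟶ Y) [Mono m] : m ≫ ξ Y = ξ X :=
  h.choose m

lemma exists_desc (h : IsLocalStateClassifier ξ) {L : E} (φ : ∀ X : E, X ⟶ L)
    (hφ : ∀ {X Y : E} (m : X ⟶ Y) [Mono m], m ≫ φ Y = φ X) :
    ∃ γ : Ξ ⟶ L, ∀ X, ξ X ≫ γ = φ X := by
  obtain ⟨w, ⟨hc⟩⟩ := h
  exact ⟨hc.desc (monoCocone φ hφ), fun X => hc.fac (monoCocone φ hφ) ⟨X⟩⟩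

lemma hom_ext (h : IsLocalStateClassifier ξ) {L : E} {γ γ' : Ξ ⟶ L}
    (hγ : ∀ X, ξ X ≫ γ = ξ X ≫ γ') : γ = γ' := by
  obtain ⟨w, ⟨hc⟩⟩ := h
  exact hc.hom_ext fun X => hγ X.obj

section Meet

variable [IsElementaryTopos E]

lemma prod_hom_ext (h : IsLocalStateClassifier ξ) (A : E) {L : E} {γ γ' : A ⨯ Ξ ⟶ L}
    (hγ : ∀ X, prod.map (𝟙 A) (ξ X) ≫ γ = prod.map (𝟙 A) (ξ X) ≫ γ') : γ = γ' := by
  let adj := Adjunction.ofIsLeftAdjoint (prod.functor.obj A)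
  apply (adj.homEquiv Ξ L).injective
  refine h.hom_ext fun X => ?_
  erw [← adj.homEquiv_naturality_left, ← adj.homEquiv_naturality_left]
  exact congrArg _ (hγ X)

lemma exists_prod_desc (h : IsLocalStateClassifier ξ) (A : E) {L : E} (φ : ∀ X : E, A ⨯ X ⟶ L)
    (hφ : ∀ {X Y : E} (m : X ⟶ Y) [Mono m], prod.map (𝟙 A) m ≫ φ Y = φ X) :
    ∃ γ : A ⨯ Ξ ⟶ L, ∀ X, prod.map (𝟙 A) (ξ X) ≫ γ = φ X := by
  let adj := Adjunction.ofIsLeftAdjoint (prod.functor.obj A)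
  obtain ⟨δ, hδ⟩ := h.exists_desc (fun X => adj.homEquiv X L (φ X)) (fun {X Y} m _ => by
    erw [← adj.homEquiv_naturality_left]
    exact congrArg _ (hφ m))
  refine ⟨(adj.homEquiv Ξ L).symm δ, fun X => ?_⟩
  erw [← adj.homEquiv_naturality_left_symm]
  rw [hδ]
  exact Equiv.symm_apply_apply _ _

/-- There is exactly one binary operation on `Ξ` that turns `(ξ X, ξ Y)` into `ξ (X ⨯ Y)`. -/
theorem existsUnique_meet (h : IsLocalStateClassifier ξ) :
    ∃! μ : Ξ ⨯ Ξ ⟶ Ξ, ∀ X Y : E, prod.map (ξ X) (ξ Y) ≫ μ = ξ (X ⨯ Y) := by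
  have key : ∀ A : E, ∃ γ : A ⨯ Ξ ⟶ Ξ, ∀ X, prod.map (𝟙 A) (ξ X) ≫ γ = ξ (A ⨯ X) := fun A =>
    h.exists_prod_desc A (fun X => ξ (A ⨯ X)) (fun m _ => h.w _)
  choose a ha using key
  obtain ⟨μ, hμ⟩ := h.exists_prod_desc Ξ (fun X => (prod.braiding Ξ X).hom ≫ a X)
    (fun {X Y} m _ => by
      have hm : prod.map m (𝟙 Ξ) ≫ a Y = a X := by
        refine h.prod_hom_ext X fun Z => ?_
        have e : prod.map m (𝟙 Z) ≫ ξ (Y ⨯ Z) = ξ (X ⨯ Z) := h.w _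
        rw [← ha, ← ha] at e
        simpa using e
      have e : prod.map (𝟙 Ξ) m ≫ (prod.braiding Ξ Y).hom =
          (prod.braiding Ξ X).hom ≫ prod.map m (𝟙 Ξ) := by simp
      rw [reassoc_of% e, hm])
  have hμ' : ∀ X Y : E, prod.map (ξ X) (ξ Y) ≫ μ = ξ (X ⨯ Y) := fun X Y => by
    have e : prod.map (ξ X) (ξ Y) = prod.map (ξ X) (𝟙 Y) ≫ prod.map (𝟙 Ξ) (ξ Y) := by simp
    have e' : prod.map (ξ X) (𝟙 Y) ≫ (prod.braiding Ξ Y).hom =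
        (prod.braiding X Y).hom ≫ prod.map (𝟙 Y) (ξ X) := by simp
    rw [e, Category.assoc, hμ, reassoc_of% e', ha]
    exact h.w _
  refine ⟨μ, hμ', fun ν hν => h.prod_hom_ext Ξ fun Y => ?_⟩
  rw [← cancel_epi (prod.braiding Y Ξ).hom]
  refine h.prod_hom_ext Y fun X => ?_
  have e : prod.map (𝟙 Y) (ξ X) ≫ (prod.braiding Y Ξ).hom ≫ prod.map (𝟙 Ξ) (ξ Y) =
      (prod.braiding Y X).hom ≫ prod.map (ξ X) (ξ Y) := by simp
  rw [reassoc_of% e, reassoc_of% e, hν, hμ']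

/-- The meet operation of the internal semilattice `Ξ`: the unique morphism `Ξ ⨯ Ξ ⟶ Ξ` with
`(ξ X × ξ Y) ≫ meet = ξ (X × Y)` for all `X`, `Y`. -/
noncomputable def meet (h : IsLocalStateClassifier ξ) : Ξ ⨯ Ξ ⟶ Ξ :=
  h.existsUnique_meet.choose

/-- The top element of the semilattice of morphisms `X ⟶ Ξ`: the composite
`X ⟶ 1 ⟶ Ξ`, whose second factor `ξ 1` is the nullary meet. -/
noncomputable def homTop (_h : IsLocalStateClassifier ξ) (X : E) : X ⟶ Ξ :=
  terminal.from X ≫ ξ (⊤_ E)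

/-- The binary meet of the semilattice of morphisms `X ⟶ Ξ`. -/
noncomputable def homInf (h : IsLocalStateClassifier ξ) {X : E} (f g : X ⟶ Ξ) : X ⟶ Ξ :=
  prod.lift f g ≫ h.meet

/-- The order on the morphisms `X ⟶ Ξ`: `f ≤ g` if and only if `f ∧ g = f`. -/
def HomLE (h : IsLocalStateClassifier ξ) {X : E} (f g : X ⟶ Ξ) : Prop :=
  h.homInf f g = f

/-- A subobject `i : F ⟶ Ξ` is an internal filter if, for every `X`, the set of the morphisms
`X ⟶ Ξ` that factor through `i` is a filter of the semilattice of all morphisms `X ⟶ Ξ`. -/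
structure IsInternalFilter (h : IsLocalStateClassifier ξ) {F : E} (i : F ⟶ Ξ) [Mono i] :
    Prop where
  top_mem (X : E) : ∃ k : X ⟶ F, k ≫ i = h.homTop X
  inf_mem {X : E} (f g : X ⟶ F) : ∃ k : X ⟶ F, k ≫ i = h.homInf (f ≫ i) (g ≫ i)
  upward {X : E} (f : X ⟶ F) (g : X ⟶ Ξ) (hfg : h.HomLE (f ≫ i) g) : ∃ k : X ⟶ F, k ≫ i = g

end Meet
end IsLocalStateClassifier

/-- The objects `X` of the full subcategory `E_F`: those for which `ξ X` factors through
`i : F ⟶ Ξ`. -/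
def inducedProperty {Ξ : E} (ξ : ∀ X : E, X ⟶ Ξ) {F : E} (i : F ⟶ Ξ) : ObjectProperty E :=
  fun X => ∃ k : X ⟶ F, k ≫ i = ξ X

/-- The full subcategory `E_F` of `E` induced by `i : F ⟶ Ξ`. -/
abbrev Induced {Ξ : E} (ξ : ∀ X : E, X ⟶ Ξ) {F : E} (i : F ⟶ Ξ) : Type u :=
  (inducedProperty ξ i).FullSubcategory

/-- The lift `ξ^F Z : Z ⟶ F` of `ξ Z` along `i`, for `Z` in `E_F`; it is unique for monic `i`. -/
noncomputable def liftedFamily {Ξ : E} (ξ : ∀ X : E, X ⟶ Ξ) {F : E} (i : F ⟶ Ξ)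
    (Z : Induced ξ i) : Z.obj ⟶ F :=
  Z.property.choose

end Classifier
end LSC

/-!
Write `E_F` for the full subcategory on the objects `X` whose local state `ξ X` factors through `F`.
Everything rests on one inequality, `homLE_comp`: `ξ X ≤ f ≫ ξ Y` for every `f : X ⟶ Y`, since the
graph of `f` is a monomorphism `X ⟶ X ⨯ Y`. If `X` is in `E_F`, then `f ≫ ξ Y` factors through `F`,
so `f` lands in the pullback of `F` along `ξ Y`, here called the core of `Y`. The core is itself
in `E_F`, so it provides a right adjoint of the inclusion, with monic counit (`coreAdj`). Moreover
`E_F` is closed under subobjects, the terminal object and binary products, hence under finite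
limits, and the cores of the exponentials and of `Ω` make it an elementary topos. Applied to the
morphisms `ξ X : X ⟶ Ξ`, the inequality gives `𝟙 Ξ ≤ ξ Ξ`, so `i ≤ i ≫ ξ Ξ = ξ F` and `F` is in
`E_F`.

For the universal property of `F`, a family `φ Z : Z ⟶ L` on `E_F` compatible with monomorphisms
gives on each `X` a partial map to `L`, defined on the core of `X`. Sending a point to the singleton
of its value, or to the empty subobject where there is none, turns this partial map into a morphism
`X ⟶ Ω ^ L` (`partialMapName`), and the partial map is recovered as the pullback of the singleton
morphism `L ⟶ Ω ^ L` (`isPullback_partialMapName`). These morphisms are compatible with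
monomorphisms, so they are induced by a single `r : Ξ ⟶ Ω ^ L`. The pullback of the singleton
morphism along `r` is `F`, because both subobjects of `Ξ` restrict along `ξ X` to the core of `X`;
this yields the required morphism `F ⟶ L` (`exists_desc_liftedFamily`).
-/

namespace LSC

/-! ### Partial maps and power objects -/

section PartialMaps

variable {E : Type u} [Category.{v} E] [IsElementaryTopos E]

/-- Characteristic morphisms are stable under pullback. -/
lemma comp_χ_of_isPullback {U V X Y : E} {m : U ⟶ X} {n : V ⟶ Y} [Mono m] [Mono n]
    {g' : U ⟶ V} {g : X ⟶ Y} (sq : IsPullback m g' g n) :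
    g ≫ HasSubobjectClassifier.χ n = HasSubobjectClassifier.χ m := by
  refine HasSubobjectClassifier.unique m _ ?_
  convert sq.paste_vert (HasSubobjectClassifier.isPullback_χ n) using 1
  exact Subsingleton.elim _ _

/-- If the subobject `m` is the pullback of `n` along `g`, as witnessed by their characteristic
morphisms, then `m ≫ g` factors through `n`. -/
lemma exists_fac_of_comp_χ_eq {U V X Y : E} {m : U ⟶ X} {n : V ⟶ Y} [Mono m] [Mono n]
    (g : X ⟶ Y) (e : g ≫ HasSubobjectClassifier.χ n = HasSubobjectClassifier.χ m) :
    ∃ k : U ⟶ V, k ≫ n = m ≫ g := by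
  refine ⟨(HasSubobjectClassifier.isPullback_χ n).lift (m ≫ g)
    (Subobject.Classifier.χ₀ _ U) ?_, IsPullback.lift_fst _ _ _ _⟩
  rw [Category.assoc, e, HasSubobjectClassifier.comm]

/-- The power object `Ω ^ L`. -/
noncomputable def powerObj (L : E) : E :=
  (prod.functor.obj L).rightAdjoint.obj (HasSubobjectClassifier.Ω E)

/-- The bijection between morphisms `L ⨯ X ⟶ Ω` and morphisms `X ⟶ Ω ^ L`. -/
noncomputable def powerEquiv (L X : E) : (L ⨯ X ⟶ HasSubobjectClassifier.Ω E) ≃ (X ⟶ powerObj L) :=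
  (Adjunction.ofIsLeftAdjoint (prod.functor.obj L)).homEquiv X _

lemma powerEquiv_comp (L : E) {X Y : E} (g : X ⟶ Y) (f : L ⨯ Y ⟶ HasSubobjectClassifier.Ω E) :
    g ≫ powerEquiv L Y f = powerEquiv L X (prod.map (𝟙 L) g ≫ f) :=
  ((Adjunction.ofIsLeftAdjoint (prod.functor.obj L)).homEquiv_naturality_left g f).symm

/-- The morphism `X ⟶ Ω ^ L` that names the graph of the partial map from `X` to `L` given by
`f : U ⟶ L` on the subobject `m : U ⟶ X`: it sends a point of `U` to the singleton of its value,
and the other points of `X` to the empty subobject of `L`. -/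
noncomputable def partialMapName {L U X : E} (f : U ⟶ L) (m : U ⟶ X) [Mono m] : X ⟶ powerObj L :=
  powerEquiv L X (HasSubobjectClassifier.χ (prod.lift f m))

lemma comp_partialMapName {L U V X Y : E} {m : U ⟶ X} {n : V ⟶ Y} [Mono m] [Mono n]
    {g' : U ⟶ V} {g : X ⟶ Y} (sq : IsPullback m g' g n) {f : U ⟶ L} {f' : V ⟶ L}
    (hf : g' ≫ f' = f) : g ≫ partialMapName f' n = partialMapName f m := by
  unfold partialMapName
  rw [powerEquiv_comp]
  congr 1
  apply comp_χ_of_isPullback (g' := g')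
  refine ⟨⟨by ext <;> simp [hf, sq.w]⟩, ⟨PullbackCone.IsLimit.mk _ (fun s => sq.lift
    (s.fst ≫ prod.snd) s.snd ?_) ?_ ?_ ?_⟩⟩
  · simpa [prod.lift_snd] using s.condition =≫ prod.snd
  · intro s
    have h1 := s.condition =≫ prod.fst
    simp only [Category.assoc, prod.map_fst, Category.comp_id, prod.lift_fst] at h1
    ext
    · simp [h1, ← hf, prod.lift_fst]
    · simp [prod.lift_snd]
  · intro s
    simp
  · intro s k h1 h2
    rw [← cancel_mono m]
    simp [← h1, prod.lift_snd]

/-- Two partial maps with the same domain of definition and the same name agree. -/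
lemma eq_of_partialMapName_eq {L U X : E} {f f' : U ⟶ L} {m : U ⟶ X} [Mono m]
    (e : partialMapName f m = partialMapName f' m) : f = f' := by
  -- Equality of names puts the graph of `f` inside the graph of `f'`.
  obtain ⟨k, hk⟩ := exists_fac_of_comp_χ_eq (m := prod.lift f m) (n := prod.lift f' m)
    (𝟙 (L ⨯ X)) (by rw [Category.id_comp]; exact ((powerEquiv L X).injective e).symm)
  have h1 := hk =≫ prod.fst
  have h2 := hk =≫ prod.snd
  simp only [prod.comp_lift, Category.comp_id, prod.lift_fst,
    prod.lift_snd] at h1 h2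
  have hk1 : k = 𝟙 U := by rw [← cancel_mono m, h2, Category.id_comp]
  rw [← h1, hk1, Category.id_comp]

/-- The singleton morphism `L ⟶ Ω ^ L`, that names the total map `𝟙 L`. -/
noncomputable def singleton (L : E) : L ⟶ powerObj L :=
  partialMapName (𝟙 L) (𝟙 L)

lemma comp_singleton {T L : E} (b : T ⟶ L) : b ≫ singleton L = partialMapName b (𝟙 T) :=
  comp_partialMapName (IsPullback.of_horiz_isIso ⟨by simp⟩) (Category.comp_id b)

instance mono_singleton (L : E) : Mono (singleton L) where
  right_cancellation b b' e := by
    rw [comp_singleton, comp_singleton] at e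
    exact eq_of_partialMapName_eq e

/-- The square exhibiting a partial map as the pullback of the singleton morphism along its
name. -/
lemma isPullback_partialMapName {L U X : E} (f : U ⟶ L) (m : U ⟶ X) [Mono m] :
    IsPullback m f (partialMapName f m) (singleton L) := by
  have hw : m ≫ partialMapName f m = f ≫ singleton L := by
    rw [comp_singleton]
    exact comp_partialMapName (g' := 𝟙 U) (IsKernelPair.id_of_mono m) (Category.id_comp f)
  -- A point `a` of `X` with value `{b}` lies in `U`: the graph of `b` is the pullback along `a` of
  -- the graph of `f`.
  have key : ∀ {T : E} (a : T ⟶ X) (b : T ⟶ L), a ≫ partialMapName f m = b ≫ singleton L →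
      ∃ k : T ⟶ U, k ≫ m = a := by
    intro T a b e
    rw [comp_singleton] at e
    unfold partialMapName at e
    rw [powerEquiv_comp] at e
    obtain ⟨k, hk⟩ := exists_fac_of_comp_χ_eq (n := prod.lift f m) (m := prod.lift b (𝟙 T))
      _ ((powerEquiv L T).injective e)
    exact ⟨k, by simpa [prod.lift_snd] using hk =≫ prod.snd⟩
  refine ⟨⟨hw⟩, ⟨PullbackCone.IsLimit.mk _ (fun s => (key s.fst s.snd s.condition).choose)
    (fun s => (key s.fst s.snd s.condition).choose_spec) (fun s => ?_) fun s k h1 h2 => ?_⟩⟩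
  · rw [← cancel_mono (singleton L), Category.assoc, ← hw, ← s.condition, ← Category.assoc,
      (key s.fst s.snd s.condition).choose_spec]
  · rw [← cancel_mono m, h1, (key s.fst s.snd s.condition).choose_spec]

end PartialMaps

section

/-! ### Local states and the closure properties of the induced subcategory -/

variable {E : Type u} [Category.{v} E] {Ξ : E} {ξ : ∀ X : E, X ⟶ Ξ}
  {h : IsLocalStateClassifier ξ} {F : E} {i : F ⟶ Ξ}

lemma inducedProperty_of_mono (h : IsLocalStateClassifier ξ) {X Y : E} (m : X ⟶ Y) [Mono m]
    (hY : inducedProperty ξ i Y) : inducedProperty ξ i X := by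
  obtain ⟨k, hk⟩ := hY
  exact ⟨m ≫ k, by rw [Category.assoc, hk, h.w]⟩

lemma liftedFamily_comp (Z : Induced ξ i) : liftedFamily ξ i Z ≫ i = ξ Z.obj :=
  Z.property.choose_spec

variable [IsElementaryTopos E]

namespace IsLocalStateClassifier

lemma lift_comp_meet (h : IsLocalStateClassifier ξ) {T X Y : E} (f : T ⟶ X) (g : T ⟶ Y) :
    prod.lift (f ≫ ξ X) (g ≫ ξ Y) ≫ h.meet = prod.lift f g ≫ ξ (X ⨯ Y) := by
  rw [← h.existsUnique_meet.choose_spec.1, ← Category.assoc, prod.lift_map]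
  rfl

/-- Local states grow along every morphism `f : X ⟶ Y`, because the graph of `f` is a monomorphism
`X ⟶ X ⨯ Y`. -/
lemma homLE_comp (h : IsLocalStateClassifier ξ) {X Y : E} (f : X ⟶ Y) :
    h.HomLE (ξ X) (f ≫ ξ Y) := by
  have e := h.lift_comp_meet (𝟙 X) f
  have : Mono (prod.lift (𝟙 X) f) := mono_of_mono_fac (prod.lift_fst (𝟙 X) f)
  rwa [Category.id_comp, h.w (prod.lift (𝟙 X) f)] at e

/-- The inequality `𝟙 Ξ ≤ ξ Ξ`, precomposed with a morphism `f`. -/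
lemma homLE_comp_classifier (h : IsLocalStateClassifier ξ) {X : E} (f : X ⟶ Ξ) :
    h.HomLE f (f ≫ ξ Ξ) := by
  have e : prod.lift (𝟙 Ξ) (ξ Ξ) ≫ h.meet = 𝟙 Ξ := h.hom_ext fun X => by
    rw [Category.comp_id, ← Category.assoc, prod.comp_lift, Category.comp_id]
    exact h.homLE_comp (ξ X)
  have e' := f ≫= e
  rwa [← Category.assoc, prod.comp_lift, Category.comp_id] at e'

end IsLocalStateClassifier

variable [Mono i]

namespace IsLocalStateClassifier.IsInternalFilter

/-- Every morphism from an object `Z` of `E_F` to `X` lands in the part of `X` whose local state is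
in `F`. -/
lemma exists_fac (hF : h.IsInternalFilter i) {Z X : E} (hZ : inducedProperty ξ i Z) (f : Z ⟶ X) :
    ∃ k : Z ⟶ F, k ≫ i = f ≫ ξ X := by
  obtain ⟨k, hk⟩ := hZ
  exact hF.upward k _ (hk ▸ h.homLE_comp f)

/-- `F` lies in `E_F` because `i ≤ i ≫ ξ Ξ = ξ F`. -/
lemma inducedProperty_self (hF : h.IsInternalFilter i) : inducedProperty ξ i F := by
  obtain ⟨k, hk⟩ := hF.upward (𝟙 F) (i ≫ ξ Ξ)
    (by rw [Category.id_comp]; exact h.homLE_comp_classifier i)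
  exact ⟨k, hk.trans (h.w i)⟩

lemma inducedProperty_prod (hF : h.IsInternalFilter i) {X Y : E} (hX : inducedProperty ξ i X)
    (hY : inducedProperty ξ i Y) : inducedProperty ξ i (X ⨯ Y) := by
  obtain ⟨k, hk⟩ := hX
  obtain ⟨l, hl⟩ := hY
  obtain ⟨t, ht⟩ := hF.inf_mem (prod.fst ≫ k : X ⨯ Y ⟶ F) (prod.snd ≫ l)
  refine ⟨t, ht.trans ?_⟩
  rw [Category.assoc, Category.assoc, hk, hl]
  refine (h.lift_comp_meet _ _).trans ?_
  rw [prod.lift_fst_snd, Category.id_comp]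

lemma inducedProperty_of_isTerminal (hF : h.IsInternalFilter i) {X : E} (hX : IsTerminal X) :
    inducedProperty ξ i X := by
  obtain ⟨k, hk⟩ := hF.top_mem X
  have : Mono (terminal.from X) := hX.mono_from _
  exact ⟨k, hk.trans (h.w _)⟩

lemma isClosedUnderLimitsOfShape_pempty (hF : h.IsInternalFilter i) :
    (inducedProperty ξ i).IsClosedUnderLimitsOfShape (Discrete PEmpty.{1}) where
  limitsOfShape_le X hX := by
    obtain ⟨p⟩ := hX
    exact hF.inducedProperty_of_isTerminal
      (isLimitChangeEmptyCone E p.isLimit (asEmptyCone X) (Iso.refl _))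

/-- A pullback is a subobject of a product. -/
lemma isClosedUnderLimitsOfShape_walkingCospan (hF : h.IsInternalFilter i) :
    (inducedProperty ξ i).IsClosedUnderLimitsOfShape WalkingCospan where
  limitsOfShape_le X hX := by
    obtain ⟨p⟩ := hX
    have : Mono (prod.lift (p.π.app WalkingCospan.left) (p.π.app WalkingCospan.right)) := by
      refine ⟨fun a b e => p.isLimit.hom_ext fun j => ?_⟩
      have e₁ := e =≫ prod.fst
      have e₂ := e =≫ prod.snd
      simp only [Category.assoc, prod.lift_fst, prod.lift_snd] at e₁ e₂
      rcases j with _ | _ | _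
      · have := p.π.naturality WalkingCospan.Hom.inl
        simp only [Functor.const_obj_obj, Functor.const_obj_map, Category.id_comp] at this
        change a ≫ p.π.app WalkingCospan.one = b ≫ p.π.app WalkingCospan.one
        rw [this, reassoc_of% e₁]
      · exact e₁
      · exact e₂
    exact inducedProperty_of_mono h
      (prod.lift (p.π.app WalkingCospan.left) (p.π.app WalkingCospan.right))
      (hF.inducedProperty_prod (p.prop_diag_obj _) (p.prop_diag_obj _))

lemma hasFiniteLimits (hF : h.IsInternalFilter i) : HasFiniteLimits (Induced ξ i) := by
  have := hF.isClosedUnderLimitsOfShape_pempty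
  have := hF.isClosedUnderLimitsOfShape_walkingCospan
  have : HasTerminal (Induced ξ i) := hasLimitsOfShape_of_closedUnderLimits _ _
  have : HasPullbacks (Induced ξ i) := hasLimitsOfShape_of_closedUnderLimits _ _
  exact hasFiniteLimits_of_hasTerminal_and_pullbacks

lemma preservesFiniteLimits_ι (hF : h.IsInternalFilter i) :
    PreservesFiniteLimits (inducedProperty ξ i).ι := by
  have := hF.isClosedUnderLimitsOfShape_pempty
  have := hF.isClosedUnderLimitsOfShape_walkingCospan
  have := hF.hasFiniteLimits
  exact preservesFiniteLimits_of_preservesTerminal_and_pullbacks _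

lemma mono_hom (hF : h.IsInternalFilter i) {X Y : Induced ξ i} (m : X ⟶ Y) [Mono m] :
    Mono m.hom :=
  have := hF.preservesFiniteLimits_ι
  inferInstanceAs (Mono ((inducedProperty ξ i).ι.map m))

/-! ### The coreflection onto the induced subcategory -/

/-- The largest subobject of `X` that lies in `E_F`: the pullback of `F` along `ξ X`. -/
noncomputable def core (_hF : h.IsInternalFilter i) (X : E) : Induced ξ i :=
  ⟨pullback (ξ X) i, pullback.snd _ _,
    pullback.condition.symm.trans (h.w (pullback.fst (ξ X) i))⟩

/-- The inclusion of the core of `X` into `X`. -/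
noncomputable def coreι (hF : h.IsInternalFilter i) (X : E) : (hF.core X).obj ⟶ X :=
  pullback.fst (ξ X) i

instance mono_coreι (hF : h.IsInternalFilter i) (X : E) : Mono (hF.coreι X) :=
  inferInstanceAs (Mono (pullback.fst (ξ X) i))

lemma isPullback_core (hF : h.IsInternalFilter i) (X : E) :
    IsPullback (hF.coreι X) (liftedFamily ξ i (hF.core X)) (ξ X) i := by
  have e : liftedFamily ξ i (hF.core X) = pullback.snd (ξ X) i := by
    apply (cancel_mono i).1
    rw [liftedFamily_comp]
    exact (h.w (hF.coreι X)).symm.trans pullback.condition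
  rw [e]
  exact IsPullback.of_hasPullback _ _

/-- Every morphism from an object of `E_F` to `X` factors through the core of `X`. -/
noncomputable def coreLift (hF : h.IsInternalFilter i) {Z : Induced ξ i} {X : E}
    (f : Z.obj ⟶ X) : Z ⟶ hF.core X :=
  ObjectProperty.homMk <| (hF.isPullback_core X).lift f (hF.exists_fac Z.property f).choose
    (hF.exists_fac Z.property f).choose_spec.symm

@[simp]
lemma coreLift_coreι (hF : h.IsInternalFilter i) {Z : Induced ξ i} {X : E} (f : Z.obj ⟶ X) :
    (hF.coreLift f).hom ≫ hF.coreι X = f :=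
  IsPullback.lift_fst _ _ _ _

lemma hom_core_ext (hF : h.IsInternalFilter i) {Z : Induced ξ i} {X : E} {f g : Z ⟶ hF.core X}
    (e : f.hom ≫ hF.coreι X = g.hom ≫ hF.coreι X) : f = g :=
  ObjectProperty.hom_ext _ ((cancel_mono _).1 e)

/-- The functor that sends an object to its core. -/
noncomputable def coreFunctor (hF : h.IsInternalFilter i) : E ⥤ Induced ξ i where
  obj := hF.core
  map {X _} f := hF.coreLift (hF.coreι X ≫ f)
  map_id X := hF.hom_core_ext (by simp)
  map_comp f g := hF.hom_core_ext (by
    rw [ObjectProperty.FullSubcategory.comp_hom, Category.assoc, coreLift_coreι, coreLift_coreι,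
      ← Category.assoc, ← Category.assoc, coreLift_coreι])

/-- The core is right adjoint to the inclusion of `E_F`. -/
noncomputable def coreAdj (hF : h.IsInternalFilter i) :
    (inducedProperty ξ i).ι ⊣ hF.coreFunctor :=
  Adjunction.mkOfHomEquiv
    { homEquiv := fun Z X =>
        { toFun := fun f => hF.coreLift f
          invFun := fun g => g.hom ≫ hF.coreι X
          left_inv := fun f => hF.coreLift_coreι f
          right_inv := fun g => hF.hom_core_ext (hF.coreLift_coreι _) }
      homEquiv_naturality_left_symm := fun f g => Category.assoc _ _ _
      homEquiv_naturality_right := fun f g => hF.hom_core_ext (by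
        change (hF.coreLift (f ≫ g)).hom ≫ _ =
          ((hF.coreLift f).hom ≫ (hF.coreLift (hF.coreι _ ≫ g)).hom) ≫ _
        rw [Category.assoc, coreLift_coreι, coreLift_coreι, ← Category.assoc, coreLift_coreι]) }

lemma coreAdj_counit_app (hF : h.IsInternalFilter i) (X : E) :
    hF.coreAdj.counit.app X = hF.coreι X := by
  change (𝟙 (hF.core X) : hF.core X ⟶ hF.core X).hom ≫ hF.coreι X = hF.coreι X
  exact Category.id_comp _

/-- The geometric morphism from `E` to `E_F`, whose inverse image is the inclusion. -/
noncomputable def geometricMorphism (hF : h.IsInternalFilter i) :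
    GeometricMorphism E (Induced ξ i) where
  inverseImage := (inducedProperty ξ i).ι
  directImage := hF.coreFunctor
  adj := hF.coreAdj
  preservesFiniteLimits := hF.preservesFiniteLimits_ι

theorem isHyperconnected_geometricMorphism (hF : h.IsInternalFilter i) :
    hF.geometricMorphism.IsHyperconnected where
  full := (inducedProperty ξ i).full_ι
  faithful := (inducedProperty ξ i).faithful_ι
  mono_counit X := by
    change Mono (hF.coreAdj.counit.app X)
    rw [hF.coreAdj_counit_app]
    exact hF.mono_coreι X

/-! ### The induced subcategory is an elementary topos -/

/-- The exponentials of `E_F` are the cores of those of `E`. -/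
lemma isLeftAdjoint_prod (hF : h.IsInternalFilter i) (X : Induced ξ i) :
    have := hF.hasFiniteLimits
    (prod.functor.obj X).IsLeftAdjoint := by
  have := hF.hasFiniteLimits
  have := hF.preservesFiniteLimits_ι
  have adj := hF.coreAdj.comp (Adjunction.ofIsLeftAdjoint (prod.functor.obj X.obj))
  exact (adj.restrictFullyFaithful (iC := 𝟭 _) (iD := (inducedProperty ξ i).ι)
    (L := prod.functor.obj X) (.id _) (inducedProperty ξ i).fullyFaithfulι
    (Functor.leftUnitor _ ≪≫ (prodComparisonNatIso (inducedProperty ξ i).ι X).symm)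
    (Functor.rightUnitor _).symm).isLeftAdjoint

/-- The core of `Ω` classifies the subobjects in `E_F`, because `E_F` is closed under subobjects
in `E`. -/
lemma hasSubobjectClassifier (hF : h.IsInternalFilter i) :
    HasSubobjectClassifier (Induced ξ i) := by
  have := hF.hasFiniteLimits
  have := hF.preservesFiniteLimits_ι
  have hT : inducedProperty ξ i (HasSubobjectClassifier.Ω₀ E) :=
    hF.inducedProperty_of_isTerminal Subobject.Classifier.isTerminalΩ₀
  have ht : IsPullback (hF.coreLift (Z := ⟨_, hT⟩) (HasSubobjectClassifier.truth E)).hom (𝟙 _)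
      (hF.coreι _) (HasSubobjectClassifier.truth E) :=
    .of_vert_isIso_mono ⟨by simp⟩
  -- Cartesian squares over the core of `truth` are those that become cartesian over `truth`.
  have key {U X : Induced ξ i} (m : U ⟶ X) (χ₀ : U ⟶ ⟨_, hT⟩)
      (c : X ⟶ hF.core (HasSubobjectClassifier.Ω E)) :
      IsPullback m χ₀ c (hF.coreLift (HasSubobjectClassifier.truth E)) ↔
        IsPullback m.hom χ₀.hom (c.hom ≫ hF.coreι _) (HasSubobjectClassifier.truth E) := by
    refine ⟨fun sq => ?_, fun sq => .of_map (inducedProperty ξ i).ι ?_ ?_⟩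
    · have sq' : IsPullback m.hom (χ₀.hom ≫ 𝟙 _) (c.hom ≫ hF.coreι _) _ :=
        (sq.map (inducedProperty ξ i).ι).paste_vert ht
      rwa [Category.comp_id] at sq'
    · exact hF.hom_core_ext (by simpa using sq.w)
    · refine .of_bot (v₂₁ := 𝟙 _) ?_ ?_ ht
      · rwa [Category.comp_id]
      · rw [← cancel_mono (hF.coreι _)]
        simpa using sq.w
  have hT' : IsTerminal (⟨_, hT⟩ : Induced ξ i) :=
    .isTerminalOfObj (inducedProperty ξ i).ι _ Subobject.Classifier.isTerminalΩ₀
  exact ⟨⟨Subobject.Classifier.mkOfTerminalΩ₀ _ hT' _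
    (hF.coreLift (HasSubobjectClassifier.truth E))
    (fun m _ => have := hF.mono_hom m; hF.coreLift (HasSubobjectClassifier.χ m.hom))
    (fun m _ => by
      have := hF.mono_hom m
      rw [key, coreLift_coreι]
      convert HasSubobjectClassifier.isPullback_χ m.hom using 1
      exact Subsingleton.elim _ _)
    (fun m _ c hc => by
      have := hF.mono_hom m
      refine hF.hom_core_ext ?_
      rw [coreLift_coreι]
      refine HasSubobjectClassifier.unique _ _ ?_
      convert (key _ _ _).1 hc using 1
      exact Subsingleton.elim _ _)⟩⟩

theorem isElementaryTopos (hF : h.IsInternalFilter i) : IsElementaryTopos (Induced ξ i) where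
  hasFiniteLimits := hF.hasFiniteLimits
  isLeftAdjoint_prod X := hF.isLeftAdjoint_prod X
  hasSubobjectClassifier := hF.hasSubobjectClassifier

/-! ### The local state classifier of the induced subcategory -/

lemma comp_liftedFamily (hF : h.IsInternalFilter i) {X Y : Induced ξ i} (m : X ⟶ Y) [Mono m] :
    m.hom ≫ liftedFamily ξ i Y = liftedFamily ξ i X := by
  have := hF.mono_hom m
  rw [← cancel_mono i, Category.assoc, liftedFamily_comp, liftedFamily_comp, h.w]

/-- If `φ` is a family of morphisms to `L` on the objects of `E_F` that is compatible with
monomorphisms, then the names of the partial maps given by `φ` on the cores form such a family on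
all objects of `E`. -/
lemma comp_partialMapName_core (hF : h.IsInternalFilter i) {L : E}
    {φ : ∀ Z : Induced ξ i, Z.obj ⟶ L}
    (hφ : ∀ {X Y : Induced ξ i} (m : X ⟶ Y) [Mono m], m.hom ≫ φ Y = φ X)
    {X Y : E} (m : X ⟶ Y) [Mono m] :
    m ≫ partialMapName (φ (hF.core Y)) (hF.coreι Y) =
      partialMapName (φ (hF.core X)) (hF.coreι X) := by
  have := mono_of_mono_fac (hF.coreLift_coreι (hF.coreι X ≫ m))
  have : Mono (hF.coreLift (hF.coreι X ≫ m)) := (inducedProperty ξ i).ι.mono_of_mono_map this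
  refine comp_partialMapName (g' := (hF.coreLift (hF.coreι X ≫ m)).hom) ?_ (hφ _)
  refine .of_bot ?_ (hF.coreLift_coreι _).symm (hF.isPullback_core Y)
  rw [hF.comp_liftedFamily, h.w]
  exact hF.isPullback_core X

/-- Families on `E_F` that are compatible with monomorphisms extend to `F`, even when their target
`L` is not in `E_F`. -/
lemma exists_desc_liftedFamily (hF : h.IsInternalFilter i) {L : E}
    (φ : ∀ Z : Induced ξ i, Z.obj ⟶ L)
    (hφ : ∀ {X Y : Induced ξ i} (m : X ⟶ Y) [Mono m], m.hom ≫ φ Y = φ X) :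
    ∃ γ : F ⟶ L, ∀ Z, liftedFamily ξ i Z ≫ γ = φ Z := by
  obtain ⟨r, hr⟩ := h.exists_desc (fun X => partialMapName (φ (hF.core X)) (hF.coreι X))
    (hF.comp_partialMapName_core hφ)
  -- `r` takes values in singletons exactly on `F`, since each composite `ξ X ≫ r` does so exactly
  -- on the core of `X`.
  have hχ : r ≫ HasSubobjectClassifier.χ (singleton L) = HasSubobjectClassifier.χ i :=
    h.hom_ext fun X => by
      rw [← Category.assoc, hr, comp_χ_of_isPullback (isPullback_partialMapName _ _),
        comp_χ_of_isPullback (hF.isPullback_core X)]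
  obtain ⟨γ, hγ⟩ := exists_fac_of_comp_χ_eq r hχ
  refine ⟨γ, fun Z => ?_⟩
  -- An object of `E_F` is its own core, so that the partial map named by `ξ Z ≫ r` is total.
  let k : Z ⟶ hF.core Z.obj := hF.coreLift (𝟙 Z.obj)
  have hk : k.hom ≫ hF.coreι Z.obj = 𝟙 Z.obj := hF.coreLift_coreι _
  have : Mono k.hom := mono_of_mono_fac hk
  have : Mono k := (inducedProperty ξ i).ι.mono_of_mono_map this
  rw [← cancel_mono (singleton L), Category.assoc, hγ, ← Category.assoc,
    liftedFamily_comp, hr, ← hφ k, Category.assoc,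
    ← (isPullback_partialMapName (φ (hF.core Z.obj)) (hF.coreι Z.obj)).w,
    ← Category.assoc, hk, Category.id_comp]

/-- The family `liftedFamily ξ i` is jointly epimorphic: a morphism `γ : F ⟶ L` is a partial map
from `Ξ` to `L`, whose name is determined by its restrictions along the `ξ X`. -/
lemma liftedFamily_hom_ext (hF : h.IsInternalFilter i) {L : E} {γ γ' : F ⟶ L}
    (e : ∀ Z : Induced ξ i, liftedFamily ξ i Z ≫ γ = liftedFamily ξ i Z ≫ γ') : γ = γ' := by
  refine eq_of_partialMapName_eq (m := i) (h.hom_ext fun X => ?_)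
  rw [comp_partialMapName (hF.isPullback_core X) rfl,
    comp_partialMapName (hF.isPullback_core X) (e _).symm]

theorem isLocalStateClassifier (hF : h.IsInternalFilter i) :
    IsLocalStateClassifier (E := Induced ξ i) (Ξ := ⟨F, hF.inducedProperty_self⟩)
      (fun Z => ObjectProperty.homMk (liftedFamily ξ i Z)) := by
  have ex (s : Cocone (monoInclusion (Induced ξ i))) :
      ∃ γ : F ⟶ s.pt.obj, ∀ Z, liftedFamily ξ i Z ≫ γ = (s.ι.app ⟨Z⟩).hom :=
    hF.exists_desc_liftedFamily (L := s.pt.obj) (fun Z => (s.ι.app ⟨Z⟩).hom) fun {X Y} m hm =>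
      congrArg (fun f => f.hom) (s.w (show (⟨X⟩ : WideSubcategory _) ⟶ ⟨Y⟩ from ⟨m, hm⟩))
  choose γ hγ using ex
  exact ⟨fun m _ => ObjectProperty.hom_ext _ (hF.comp_liftedFamily m),
    ⟨{ desc := fun s => ObjectProperty.homMk (γ s)
       fac := fun s Z => ObjectProperty.hom_ext _ (hγ s Z.obj)
       uniq := fun s δ hδ => ObjectProperty.hom_ext _ <| hF.liftedFamily_hom_ext fun Z =>
        (congrArg (fun f => f.hom) (hδ ⟨Z⟩)).trans (hγ s Z).symm }⟩⟩

end IsLocalStateClassifier.IsInternalFilter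
end
end LSC

theorem theorem3p1 {E : Type u} [Category.{v} E] [LSC.IsElementaryTopos E] {Ξ : E}
    (ξ : ∀ X : E, X ⟶ Ξ) (h : LSC.IsLocalStateClassifier ξ)
    {F : E} (i : F ⟶ Ξ) [Mono i] (hF : h.IsInternalFilter i) :
    LSC.IsElementaryTopos (LSC.Induced ξ i) ∧
    (∃ f : LSC.GeometricMorphism E (LSC.Induced ξ i),
      f.inverseImage = (LSC.inducedProperty ξ i).ι ∧ f.IsHyperconnected) ∧
    ∃ hFF : LSC.inducedProperty ξ i F,
      LSC.IsLocalStateClassifier (E := LSC.Induced ξ i) (Ξ := ⟨F, hFF⟩)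
        (fun Z => ObjectProperty.homMk (LSC.liftedFamily ξ i Z)) :=
  ⟨hF.isElementaryTopos, ⟨hF.geometricMorphism, rfl, hF.isHyperconnected_geometricMorphism⟩,
    hF.inducedProperty_self, hF.isLocalStateClassifier⟩
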